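/- Let $T>0$, $n,m\ge 0$ integers, $B\in\mathbb R^{n\times m}$, $C\in\mathbb R^{m\times n}$, $D\in\mathbb R^m$, and let $f:[0,T]\times\mathbb R^n\to\mathbb R^n$. Write $\operatorname{sgn}$ for the multivalued sign, $\operatorname{sgn}(\xi)=\{1\}$ for $\xi>0$, $\operatorname{sgn}(\xi)=\{-1\}$ for $\xi<0$, $\operatorname{sgn}(0)=[-1,1]$, and $\operatorname{Sgn}(y)=\operatorname{sgn}(y_1)\times\dots\times\operatorname{sgn}(y_m)$ for $y\in\mathbb R^m$. Consider the differential inclusion $$\dot x(t)\in f(t,x(t))-B\operatorname{Sgn}(Cx(t)+D)\quad\text{for a.e. }t\in(0,T),\qquad x(0)=x_0, \tag{1}$$ where a solution is an absolutely continuous function $x:[0,T]\to\mathbb R^n$ satisfying (1). Suppose that: (ii) there is $L\ge 0$ such that $\|f(t,x_1)-f(t,x_2)\|\le L\|x_1-x_2\|$ for all $t\in[0,T]$ and all $x_1,x_2\in\mathbb R^n$; (iii) for every $x\in\mathbb R^n$ the function $f(\cdot,x)$ is weakly differentiable on $(0,T)$ (locally integrable with locally integrable distributional derivative), and there is a version $\frac{\partial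 f}{\partial t}$ of its derivative (that is, a function on $(0,T)\times\mathbb R^n$ such that for every $x$, $\frac{\partial f}{\partial t}(\cdot,x)$ is a weak derivative of $f(\cdot,x)$) such that for every $R\ge 0$ $$\Phi(R)=\sup\left\{\left\|\tfrac{\partial f}{\partial t}(\cdot,v(\cdot))\right\|_{L^2((0,T);\mathbb R^n)}\;:\;v\in L^2((0,T);\mathbb R^n),\ \|v\|_{L^2((0,T);\mathbb R^n)}\le R\right\}<+\infty .$$ If there exists a symmetric positive definite matrix $P\in\mathbb R^{n\times n}$ such that $PB_{\bullet i}=C_{i\bullet}^T$ for all $1\le i\le m$ (where $B_{\bullet i}$ is the $i$-th column of $B$ and $C_{i\bullet}$ the $i$-th row of $C$), then for every $x_0\in\mathbb R^n$ the differential inclusion (1) has a unique solution on $[0,T]$, and this solution is Lipschitz continuous. -/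

import Mathlib

open MeasureTheory Set
open scoped NNReal ENNReal Matrix ContDiff

namespace SlidingMode

/-- The multivalued sign: `{1}` on positive reals, `{-1}` on negative reals, `[-1,1]` at `0`. -/
def sgn (ξ : ℝ) : Set ℝ :=
  {s | (0 < ξ ∧ s = 1) ∨ (ξ < 0 ∧ s = -1) ∨ (ξ = 0 ∧ s ∈ Icc (-1 : ℝ) 1)}

/-- The componentwise multivalued sign on `ℝᵐ`. -/
def Sgn {m : ℕ} (y : Fin m → ℝ) : Set (Fin m → ℝ) :=
  {s | ∀ i, s i ∈ sgn (y i)}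

/-- The set `F - B Sgn(C x + D)`, where `F` is the value of the single-valued part. -/
def rhs {n m : ℕ} (F : EuclideanSpace ℝ (Fin n)) (B : Matrix (Fin n) (Fin m) ℝ)
    (C : Matrix (Fin m) (Fin n) ℝ) (D : Fin m → ℝ) (x : EuclideanSpace ℝ (Fin n)) :
    Set (EuclideanSpace ℝ (Fin n)) :=
  {y | ∃ s ∈ Sgn (C *ᵥ x.ofLp + D), y = F - WithLp.toLp 2 (B *ᵥ s)}

/-- `x` is a solution on `[0,T]` of the differential inclusion
`ẋ(t) ∈ f(t, x(t)) - B Sgn(C x(t) + D)` for almost every `t ∈ (0,T)`, with `x(0) = x₀`: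
it is absolutely continuous, and at almost every time it is differentiable with its derivative
in the right-hand side. -/
def IsSolution {n m : ℕ} (T : ℝ)
    (f : ℝ → EuclideanSpace ℝ (Fin n) → EuclideanSpace ℝ (Fin n))
    (B : Matrix (Fin n) (Fin m) ℝ) (C : Matrix (Fin m) (Fin n) ℝ) (D : Fin m → ℝ)
    (x₀ : EuclideanSpace ℝ (Fin n)) (x : ℝ → EuclideanSpace ℝ (Fin n)) : Prop :=
  AbsolutelyContinuousOnInterval x 0 T ∧ x 0 = x₀ ∧
    ∀ᵐ t ∂(volume.restrict (Ioo 0 T)),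
      ∃ x' : EuclideanSpace ℝ (Fin n), HasDerivAt x x' t ∧ x' ∈ rhs (f t (x t)) B C D (x t)

/-- `w` is a weak (distributional) derivative of `u` on the interval `(0,T)`. A function that is
differentiable at every point of `(0,T)` with locally integrable derivative has this derivative as
a weak derivative. -/
def IsWeakDeriv {n : ℕ} (T : ℝ) (u w : ℝ → EuclideanSpace ℝ (Fin n)) : Prop :=
  LocallyIntegrableOn u (Ioo 0 T) ∧ LocallyIntegrableOn w (Ioo 0 T) ∧
    ∀ φ : ℝ → ℝ, ContDiff ℝ ∞ φ → HasCompactSupport φ → tsupport φ ⊆ Ioo 0 T →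
      ∫ t in Ioo 0 T, deriv φ t • u t = -∫ t in Ioo 0 T, φ t • w t

/-- `Φ(R)`: the supremum of the norm of `t ↦ g(t, v(t))` in `L²((0,T); ℝⁿ)` over all
`v ∈ L²((0,T); ℝⁿ)` of norm at most `R`, as an extended nonnegative real. -/
noncomputable def supNorm {n : ℕ} (T : ℝ)
    (g : ℝ → EuclideanSpace ℝ (Fin n) → EuclideanSpace ℝ (Fin n)) (R : ℝ≥0) : ℝ≥0∞ :=
  ⨆ (v : ℝ → EuclideanSpace ℝ (Fin n)) (_ : MemLp v 2 (volume.restrict (Ioo 0 T)))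
    (_ : eLpNorm v 2 (volume.restrict (Ioo 0 T)) ≤ R),
    eLpNorm (fun t => g t (v t)) 2 (volume.restrict (Ioo 0 T))

/-- The condition on the partial derivative in time: for every `x`, the function `t ↦ f(t,x)` has
the weak derivative `∂f/∂t(·,x) = g(·,x)` on `(0,T)`, and `v ↦ ∂f/∂t(·,v)` maps bounded subsets of
`L²((0,T); ℝⁿ)` to bounded sets, that is, `Φ(R) < ∞` for every `R ≥ 0`. -/
def TimeDerivBound {n : ℕ} (T : ℝ)
    (f : ℝ → EuclideanSpace ℝ (Fin n) → EuclideanSpace ℝ (Fin n)) : Prop :=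
  ∃ g : ℝ → EuclideanSpace ℝ (Fin n) → EuclideanSpace ℝ (Fin n),
    (∀ x, IsWeakDeriv T (fun t => f t x) (fun t => g t x)) ∧
      ∀ R : ℝ≥0, supNorm T g R < ⊤

end SlidingMode

namespace SlidingMode

open Filter Topology

/-! In the inner product `⟨P x, y⟩` the discontinuous term is dissipative: `PB = Cᵀ` gives `⟨P z, B
(s - s')⟩ = (s - s') · C z`, which is nonnegative when `z = x - y` and `s`, `s'` are signs of `C x +
D` and `C y + D`. So `V = ⟨P z, z⟩` satisfies `V' ≤ k V` along two solutions, and Grönwall yields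
uniqueness (`norm_sq_le_of_monotone` with `η = 0`).

For existence, `sgn` is replaced by a truncation of slope `k + 1`. The controls stay bounded by `1`,
so the approximate solutions share a Lipschitz constant. Two truncations are monotone only up to an
error `O(1/k + 1/l)` (`clip_almost_monotone`), and the same Grönwall estimate makes the sequence
uniformly Cauchy. The limit solves the inclusion because its derivative cannot be separated from the
compact convex right-hand side (`mem_of_hasDerivAt_of_tendsto`).

Regularity in time enters through `exists_continuous_vectorField`: the bound on `Φ`, tested on
constant `v`, makes the weak derivative integrable, so `f` may be replaced by a field continuous in
time, equal to it for a.e. `t`. -/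

/-! ### Weak derivatives and continuous representatives -/

/-- The product of a continuous function with compact support in `U` and a function locally
integrable on `U` is integrable. -/
lemma integrable_smul_of_tsupport_subset {E : Type*} [NormedAddCommGroup E] [NormedSpace ℝ E]
    {U : Set ℝ} {u : ℝ → E} (hu : LocallyIntegrableOn u U) {φ : ℝ → ℝ}
    (hφ : Continuous φ) (hc : HasCompactSupport φ) (hs : tsupport φ ⊆ U) :
    Integrable (fun t => φ t • u t) := by
  have h1 : IntegrableOn (fun t => φ t • u t) (tsupport φ) :=
    (hu.integrableOn_compact_subset hs hc).continuousOn_smul hφ.continuousOn hc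
  rw [integrableOn_iff_integrable_of_support_subset] at h1
  · exact h1
  · intro t ht
    apply subset_tsupport φ
    intro h
    exact ht (by simp [h])

lemma setIntegral_smul_of_tsupport_subset {E : Type*} [NormedAddCommGroup E] [NormedSpace ℝ E]
    {U : Set ℝ} (u : ℝ → E) {φ : ℝ → ℝ} (hs : tsupport φ ⊆ U) :
    ∫ t in U, φ t • u t = ∫ t, φ t • u t := by
  apply setIntegral_eq_integral_of_forall_compl_eq_zero
  intro t ht
  rw [image_eq_zero_of_notMem_tsupport (fun h => ht (hs h)), zero_smul]

/-- A smooth function of zero integral with compact support in `(0,T)` is the derivative of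
a smooth function with compact support in `(0,T)`. -/
lemma exists_test_primitive {T : ℝ} {ψ : ℝ → ℝ} (hψ : ContDiff ℝ ∞ ψ)
    (hc : HasCompactSupport ψ) (hs : tsupport ψ ⊆ Ioo 0 T) (h0 : ∫ t, ψ t = 0) :
    ∃ φ : ℝ → ℝ, ContDiff ℝ ∞ φ ∧ HasCompactSupport φ ∧ tsupport φ ⊆ Ioo 0 T ∧ deriv φ = ψ := by
  rcases (tsupport ψ).eq_empty_or_nonempty with he | hne
  · refine ⟨0, contDiff_const, HasCompactSupport.zero, by simp [tsupport], ?_⟩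
    rw [tsupport_eq_empty_iff] at he
    rw [he]
    ext t
    simp
  obtain ⟨a, haK, ha⟩ := IsCompact.exists_isLeast hc hne
  obtain ⟨b, hbK, hb⟩ := IsCompact.exists_isGreatest hc hne
  have hzero : ∀ t, t ∉ Icc a b → ψ t = 0 := fun t ht =>
    image_eq_zero_of_notMem_tsupport (fun h => ht ⟨ha h, hb h⟩)
  have hd : ∀ t, HasDerivAt (fun x => ∫ s in (0:ℝ)..x, ψ s) (ψ t) t := fun t =>
    intervalIntegral.integral_hasDerivAt_right (hψ.continuous.intervalIntegrable _ _)
      (hψ.continuous.stronglyMeasurableAtFilter _ _) hψ.continuous.continuousAt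
  have hder : deriv (fun x => ∫ s in (0:ℝ)..x, ψ s) = ψ := funext fun t => (hd t).deriv
  have ha0 := hs haK
  have hb0 := hs hbK
  have hsupp : Function.support (fun x => ∫ s in (0:ℝ)..x, ψ s) ⊆ Icc a b := by
    intro x hx
    by_contra hxn
    apply hx
    simp only [mem_Icc, not_and_or, not_le] at hxn
    rcases hxn with hxa | hxb
    · change ∫ s in (0:ℝ)..x, ψ s = 0
      rw [intervalIntegral.integral_congr_ae (g := fun _ => (0 : ℝ)), intervalIntegral.integral_zero]
      refine Eventually.of_forall fun s hs' => hzero s fun hs'' => ?_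
      have : s < a := lt_of_le_of_lt hs'.2 (max_lt ha0.1 hxa)
      exact absurd hs''.1 (not_le.2 this)
    · change ∫ s in (0:ℝ)..x, ψ s = 0
      have hx0 : 0 ≤ x := (hb0.1.trans hxb).le
      rw [intervalIntegral.integral_of_le hx0]
      -- To the right of the support the primitive is the full integral; this is where zero mean is
      -- needed.
      refine Eq.trans ?_ h0
      apply setIntegral_eq_integral_of_forall_compl_eq_zero
      intro s hs'
      apply hzero
      intro hs''
      exact hs' ⟨lt_of_lt_of_le ha0.1 hs''.1, hs''.2.trans hxb.le⟩
  have hts : tsupport (fun x => ∫ s in (0:ℝ)..x, ψ s) ⊆ Icc a b :=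
    closure_minimal hsupp isClosed_Icc
  refine ⟨_, ?_, ?_, hts.trans (Icc_subset_Ioo ha0.1 hb0.2), hder⟩
  · rw [contDiff_infty_iff_deriv, hder]
    exact ⟨fun t => (hd t).differentiableAt, hψ⟩
  · exact isCompact_Icc.of_isClosed_subset (isClosed_tsupport _) hts

/-- The **du Bois-Reymond lemma**. -/
lemma ae_eq_const_of_integral_deriv_mul_eq_zero {T : ℝ} (hT : 0 < T) {v : ℝ → ℝ}
    (hv : LocallyIntegrableOn v (Ioo 0 T))
    (h : ∀ φ : ℝ → ℝ, ContDiff ℝ ∞ φ → HasCompactSupport φ → tsupport φ ⊆ Ioo 0 T →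
      ∫ t, deriv φ t • v t = 0) :
    ∃ c : ℝ, ∀ᵐ t, t ∈ Ioo 0 T → v t = c := by
  -- A bump supported in `[T/4, 3T/4]`; the constant sought is the mean of `v` against it.
  let ρ : ContDiffBump (T / 2) := ⟨T / 8, T / 4, by positivity, by linarith⟩
  have hρs : tsupport (ρ.normed volume) ⊆ Ioo 0 T := by
    rw [ρ.tsupport_normed_eq, Real.closedBall_eq_Icc]
    apply Icc_subset_Ioo <;> simp only [ρ] <;> linarith
  have hρd : ContDiff ℝ ∞ (ρ.normed volume) := ρ.contDiff_normed
  have hρc : HasCompactSupport (ρ.normed volume) := ρ.hasCompactSupport_normed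
  have hρi := integrable_smul_of_tsupport_subset hv hρd.continuous hρc hρs
  refine ⟨∫ t, ρ.normed volume t • v t, ?_⟩
  have key := IsOpen.ae_eq_zero_of_integral_contDiff_smul_eq_zero (μ := volume)
    (f := fun t => v t - ∫ t, ρ.normed volume t • v t) isOpen_Ioo
    (hv.sub ((locallyIntegrable_const _).locallyIntegrableOn _)) ?_
  · filter_upwards [key] with t ht htT
    exact sub_eq_zero.1 (ht htT)
  intro g hg hgc hgs
  have hgi := integrable_smul_of_tsupport_subset hv hg.continuous hgc hgs
  -- Subtracting `I` times the normalized bump gives `g` zero mean, hence makes it a derivative of a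
  -- test function.
  set I := ∫ t, g t with hI
  have hsub : Function.support (fun t => g t - I * ρ.normed volume t) ⊆
      tsupport g ∪ tsupport (ρ.normed volume) := by
    intro t ht
    by_contra hn
    rw [mem_union, not_or] at hn
    apply ht
    simp [image_eq_zero_of_notMem_tsupport hn.1, image_eq_zero_of_notMem_tsupport hn.2]
  have hts : tsupport (fun t => g t - I * ρ.normed volume t) ⊆
      tsupport g ∪ tsupport (ρ.normed volume) :=
    closure_minimal hsub ((isClosed_tsupport _).union (isClosed_tsupport _))
  obtain ⟨φ, hφ, hφc, hφs, hφd⟩ := exists_test_primitive (T := T)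
    (ψ := fun t => g t - I * ρ.normed volume t) (hg.sub (contDiff_const.mul hρd))
    ((hgc.isCompact.union hρc.isCompact).of_isClosed_subset (isClosed_tsupport _) hts)
    (hts.trans (union_subset hgs hρs)) (by
      rw [integral_sub (hg.continuous.integrable_of_hasCompactSupport hgc)
        (ρ.integrable_normed.const_mul _), integral_const_mul, ρ.integral_normed]
      simp [hI])
  have h1 := h φ hφ hφc hφs
  rw [hφd] at h1
  have h2 : ∀ t, (g t - I * ρ.normed volume t) • v t
      = g t • v t - I * (ρ.normed volume t • v t) := by
    intro t; simp only [smul_eq_mul]; ring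
  simp only [h2] at h1
  rw [integral_sub hgi (hρi.const_mul _), integral_const_mul] at h1
  simp only [smul_sub]
  rw [integral_sub hgi ((hg.continuous.integrable_of_hasCompactSupport hgc).smul_const _),
    integral_smul_const, ← hI, smul_eq_mul]
  exact h1

/-- A function on `(0,T)` with an integrable weak derivative has a continuous representative. -/
lemma exists_continuous_ae_eq_of_weakDeriv {T : ℝ} (hT : 0 < T) {u w : ℝ → ℝ}
    (hu : LocallyIntegrableOn u (Ioo 0 T)) (hw : IntegrableOn w (Ioo 0 T))
    (h : ∀ φ : ℝ → ℝ, ContDiff ℝ ∞ φ → HasCompactSupport φ → tsupport φ ⊆ Ioo 0 T →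
      ∫ t, deriv φ t • u t = -∫ t, φ t • w t) :
    ∃ U : ℝ → ℝ, Continuous U ∧ ∀ᵐ t, t ∈ Ioo 0 T → u t = U t := by
  set W := (Ioo 0 T).indicator w with hW
  have hWi : Integrable W := hw.integrable_indicator measurableSet_Ioo
  set U : ℝ → ℝ := fun t => ∫ s in (0:ℝ)..t, W s with hU
  have hUc : Continuous U :=
    intervalIntegral.continuous_primitive (fun a b => hWi.intervalIntegrable) 0
  have hUac : AbsolutelyContinuousOnInterval U 0 T :=
    IntervalIntegrable.absolutelyContinuousOnInterval_intervalIntegral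
      hWi.intervalIntegrable (by simp)
  have hUd := LocallyIntegrable.ae_hasDerivAt_integral hWi.locallyIntegrable
  have hUl : LocallyIntegrableOn U (Ioo 0 T) := hUc.locallyIntegrable.locallyIntegrableOn _
  -- Integration by parts shows that `U` also has weak derivative `w`, so `u - U` has weak
  -- derivative zero.
  obtain ⟨c, hc⟩ := ae_eq_const_of_integral_deriv_mul_eq_zero hT (v := fun t => u t - U t)
    (hu.sub hUl) (by
      intro φ hφ hφc hφs
      have hφ' : tsupport (deriv φ) ⊆ Ioo 0 T := tsupport_deriv_subset.trans hφs
      have hdc : Continuous (deriv φ) := hφ.continuous_deriv (by simp)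
      simp only [smul_sub]
      rw [integral_sub (integrable_smul_of_tsupport_subset hu hdc hφc.deriv hφ')
        (integrable_smul_of_tsupport_subset hUl hdc hφc.deriv hφ'), h φ hφ hφc hφs]
      have hφac : AbsolutelyContinuousOnInterval φ 0 T :=
        (hφ.of_le (by simp)).contDiffOn.absolutelyContinuousOnInterval
      have hibp := hUac.integral_mul_deriv_eq_deriv_mul hφac
      have hφ0 : φ 0 = 0 := image_eq_zero_of_notMem_tsupport fun h => lt_irrefl _ (hφs h).1
      have hφT : φ T = 0 := image_eq_zero_of_notMem_tsupport fun h => lt_irrefl _ (hφs h).2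
      rw [hφ0, hφT, intervalIntegral.integral_of_le hT.le, intervalIntegral.integral_of_le hT.le,
        integral_Ioc_eq_integral_Ioo, integral_Ioc_eq_integral_Ioo] at hibp
      rw [← setIntegral_smul_of_tsupport_subset U hφ', ← setIntegral_smul_of_tsupport_subset w hφs]
      have e1 : ∫ t in Ioo 0 T, deriv φ t • U t = ∫ t in Ioo 0 T, U t * deriv φ t := by
        simp only [smul_eq_mul, mul_comm]
      have e2 : ∫ t in Ioo 0 T, φ t • w t = ∫ t in Ioo 0 T, deriv U t * φ t := by
        apply setIntegral_congr_ae measurableSet_Ioo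
        filter_upwards [hUd] with t ht htT
        rw [(ht 0).deriv, hW, indicator_of_mem htT, smul_eq_mul, mul_comm]
      rw [e1, e2, hibp]
      ring)
  refine ⟨fun t => U t + c, hUc.add continuous_const, ?_⟩
  filter_upwards [hc] with t ht htT
  linarith [ht htT]

/-- A weakly differentiable function with integrable weak derivative has a continuous
representative. -/
lemma IsWeakDeriv.exists_continuous_ae_eq {n : ℕ} {T : ℝ} (hT : 0 < T)
    {u w : ℝ → EuclideanSpace ℝ (Fin n)} (h : IsWeakDeriv T u w) (hw : IntegrableOn w (Ioo 0 T)) :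
    ∃ U : ℝ → EuclideanSpace ℝ (Fin n), Continuous U ∧ ∀ᵐ t, t ∈ Ioo 0 T → u t = U t := by
  obtain ⟨hu, hwl, h⟩ := h
  have key : ∀ i, ∃ U : ℝ → ℝ, Continuous U ∧ ∀ᵐ t, t ∈ Ioo 0 T → u t i = U t := by
    intro i
    let p : EuclideanSpace ℝ (Fin n) →L[ℝ] ℝ := EuclideanSpace.proj i
    have hl : ∀ v : ℝ → EuclideanSpace ℝ (Fin n), LocallyIntegrableOn v (Ioo 0 T) →
        LocallyIntegrableOn (fun t => v t i) (Ioo 0 T) := by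
      intro v hv t ht
      obtain ⟨s, hs, hvs⟩ := hv t ht
      exact ⟨s, hs, p.integrable_comp hvs⟩
    refine exists_continuous_ae_eq_of_weakDeriv hT (w := fun t => w t i) (hl u hu)
      (p.integrable_comp hw) ?_
    intro φ hφ hφc hφs
    have hφ' : tsupport (deriv φ) ⊆ Ioo 0 T := tsupport_deriv_subset.trans hφs
    have hdc : Continuous (deriv φ) := hφ.continuous_deriv (by simp)
    have h1 := h φ hφ hφc hφs
    rw [setIntegral_smul_of_tsupport_subset u hφ', setIntegral_smul_of_tsupport_subset w hφs] at h1
    have h2 := congrArg p h1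
    rw [map_neg, ← p.integral_comp_comm (integrable_smul_of_tsupport_subset hu hdc hφc.deriv hφ'),
      ← p.integral_comp_comm (integrable_smul_of_tsupport_subset hwl hφ.continuous hφc hφs)] at h2
    simpa [p] using h2
  choose U hUc hU using key
  refine ⟨fun t => WithLp.toLp 2 fun i => U i t,
    (PiLp.continuous_toLp 2 _).comp (continuous_pi hUc), ?_⟩
  filter_upwards [ae_all_iff.2 hU] with t ht htT
  ext i
  exact ht i htT

/-- Under `TimeDerivBound`, the weak derivative of `f(·,x)` is integrable on `(0,T)`. -/
lemma integrableOn_of_supNorm_lt_top {n : ℕ} {T : ℝ}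
    {g : ℝ → EuclideanSpace ℝ (Fin n) → EuclideanSpace ℝ (Fin n)}
    (hg : ∀ R : ℝ≥0, supNorm T g R < ⊤) (x : EuclideanSpace ℝ (Fin n))
    (hm : LocallyIntegrableOn (fun t => g t x) (Ioo 0 T)) :
    IntegrableOn (fun t => g t x) (Ioo 0 T) := by
  -- Constants are admissible in the supremum because `(0,T)` has finite measure.
  have hx : MemLp (fun _ : ℝ => x) 2 (volume.restrict (Ioo 0 T)) := memLp_const x
  have h2 : MemLp (fun t => g t x) 2 (volume.restrict (Ioo 0 T)) := by
    refine ⟨hm.aestronglyMeasurable, lt_of_le_of_lt ?_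
      (hg (eLpNorm (fun _ : ℝ => x) 2 (volume.restrict (Ioo 0 T))).toNNReal)⟩
    refine le_iSup_of_le (fun _ => x) (le_iSup_of_le hx (le_iSup_of_le ?_ le_rfl))
    rw [ENNReal.coe_toNNReal hx.2.ne]
  exact h2.integrable (by norm_num)

/-- The time-dependent vector field `f` agrees for almost every time with one which is continuous
in time and Lipschitz in space. -/
lemma exists_continuous_vectorField {n : ℕ} {T : ℝ} (hT : 0 < T)
    {f : ℝ → EuclideanSpace ℝ (Fin n) → EuclideanSpace ℝ (Fin n)} {L : ℝ≥0}
    (hf : ∀ t ∈ Icc 0 T, LipschitzWith L (f t)) (hf_time : TimeDerivBound T f) :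
    ∃ F : ℝ → EuclideanSpace ℝ (Fin n) → EuclideanSpace ℝ (Fin n),
      (∀ x, Continuous fun t => F t x) ∧ (∀ t, LipschitzWith L (F t)) ∧
      ∀ᵐ t, t ∈ Ioo 0 T → f t = F t := by
  obtain ⟨g, hg, hR⟩ := hf_time
  have key : ∀ x, ∃ U : ℝ → EuclideanSpace ℝ (Fin n), Continuous U ∧
      ∀ᵐ t, t ∈ Ioo 0 T → f t x = U t := fun x =>
    (hg x).exists_continuous_ae_eq hT (integrableOn_of_supNorm_lt_top hR x (hg x).2.1)
  choose U hUc hU using key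
  have hlip : ∀ x y, ∀ t ∈ Icc 0 T, dist (U x t) (U y t) ≤ L * dist x y := by
    intro x y t ht
    have hcl : IsClosed {t | dist (U x t) (U y t) ≤ L * dist x y} :=
      isClosed_le ((hUc x).dist (hUc y)) continuous_const
    have hae : ∀ᵐ t ∂(volume.restrict (Ioo 0 T)), dist (U x t) (U y t) ≤ L * dist x y := by
      rw [ae_restrict_iff' measurableSet_Ioo]
      filter_upwards [hU x, hU y] with t h1 h2 htT
      rw [← h1 htT, ← h2 htT]
      exact (hf t (Ioo_subset_Icc_self htT)).dist_le_mul x y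
    -- The exceptional set in `(0,T)` is open and null, hence empty.
    have hsub : Ioo 0 T ⊆ {t | dist (U x t) (U y t) ≤ L * dist x y} := by
      by_contra hn
      obtain ⟨s, hs, hsn⟩ := not_subset.1 hn
      have hopen : IsOpen (Ioo 0 T ∩ {t | dist (U x t) (U y t) ≤ L * dist x y}ᶜ) :=
        isOpen_Ioo.inter hcl.isOpen_compl
      have hpos := hopen.measure_pos volume ⟨s, hs, hsn⟩
      rw [ae_iff, Measure.restrict_apply' measurableSet_Ioo] at hae
      refine hpos.ne' ?_
      rw [inter_comm]
      exact hae
    have := closure_minimal hsub hcl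
    rw [closure_Ioo hT.ne] at this
    exact this ht
  -- Clamping time to `[0,T]` makes the Lipschitz bound hold for every real `t`.
  refine ⟨fun t x => U x (projIcc 0 T hT.le t),
    fun x => (hUc x).comp (continuous_subtype_val.comp continuous_projIcc),
    fun t => LipschitzWith.of_dist_le_mul fun x y => hlip x y _ (projIcc 0 T hT.le t).2, ?_⟩
  -- The null set of `hU x` depends on `x`; a countable dense set of `x` gives a common one, and
  -- continuity in space does the rest.
  obtain ⟨Q, hQc, hQd⟩ := TopologicalSpace.exists_countable_dense (EuclideanSpace ℝ (Fin n))
  have hall : ∀ᵐ t, ∀ x ∈ Q, t ∈ Ioo 0 T → f t x = U x t :=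
    (ae_ball_iff hQc).2 fun x _ => hU x
  filter_upwards [hall] with t ht htT
  have htI := Ioo_subset_Icc_self htT
  refine Continuous.ext_on hQd (hf t htI).continuous (LipschitzWith.of_dist_le_mul (K := L)
    fun x y => hlip x y _ (projIcc 0 T hT.le t).2).continuous fun x hx => ?_
  rw [projIcc_of_mem hT.le htI]
  exact ht x hx htT

/-! ### Grönwall's inequality and comparison of trajectories -/

/-- The composition of a function Lipschitz on `s` with an absolutely continuous function with
values in `s` is absolutely continuous. -/
lemma absolutelyContinuousOnInterval_comp_lipschitzOnWith {X Y : Type*} [PseudoMetricSpace X]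
    [PseudoMetricSpace Y] {x : ℝ → X} {a b : ℝ} (hx : AbsolutelyContinuousOnInterval x a b)
    {h : X → Y} {s : Set X} {K : ℝ≥0} (hh : LipschitzOnWith K h s) (hs : MapsTo x (uIcc a b) s) :
    AbsolutelyContinuousOnInterval (fun t => h (x t)) a b := by
  rw [absolutelyContinuousOnInterval_iff] at hx ⊢
  intro ε hε
  obtain ⟨δ, hδ, H⟩ := hx (ε / (K + 1)) (by positivity)
  refine ⟨δ, hδ, fun E hE hl => ?_⟩
  have h1 := H E hE hl
  calc ∑ i ∈ Finset.range E.1, dist (h (x (E.2 i).1)) (h (x (E.2 i).2))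
      ≤ ∑ i ∈ Finset.range E.1, K * dist (x (E.2 i).1) (x (E.2 i).2) :=
        Finset.sum_le_sum fun i hi =>
          hh.dist_le_mul _ (hs (hE.1 i hi).1) _ (hs (hE.1 i hi).2)
    _ = K * ∑ i ∈ Finset.range E.1, dist (x (E.2 i).1) (x (E.2 i).2) := by
        rw [Finset.mul_sum]
    _ ≤ K * (ε / (K + 1)) := by gcongr
    _ < (K + 1) * (ε / (K + 1)) := by
        have : 0 < ε / ((K : ℝ) + 1) := by positivity
        nlinarith
    _ = ε := by field_simp

/-- The **Grönwall inequality** for absolutely continuous functions. -/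
lemma le_mul_exp_of_absolutelyContinuous {V : ℝ → ℝ} {T k η : ℝ} (hk : 0 ≤ k) (hη : 0 ≤ η)
    (hV : AbsolutelyContinuousOnInterval V 0 T) (h0 : V 0 = 0)
    (hd : ∀ᵐ t, t ∈ Ioo 0 T → deriv V t ≤ k * V t + η) :
    ∀ t ∈ Icc 0 T, V t ≤ η * t * Real.exp (k * t) := by
  intro t ht
  have hVt : AbsolutelyContinuousOnInterval V 0 t := by
    refine hV.mono ?_
    rw [uIcc_of_le ht.1, uIcc_of_le (ht.1.trans ht.2)]
    exact Icc_subset_Icc_right ht.2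
  have he : ContDiff ℝ 1 fun s : ℝ => Real.exp (-(k * s)) := by fun_prop
  have heac : AbsolutelyContinuousOnInterval (fun s : ℝ => Real.exp (-(k * s))) 0 t :=
    he.contDiffOn.absolutelyContinuousOnInterval
  -- With this integrating factor the derivative is at most `η exp(-ks) ≤ η`.
  have hac : AbsolutelyContinuousOnInterval (fun s => V s * Real.exp (-(k * s))) 0 t :=
    hVt.mul heac
  have hint := hac.integral_deriv_eq_sub
  have hle : ∫ s in (0:ℝ)..t, deriv (fun s => V s * Real.exp (-(k * s))) s ≤
      ∫ _ in (0:ℝ)..t, η := by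
    apply intervalIntegral.integral_mono_ae_restrict ht.1 hac.intervalIntegrable_deriv
      intervalIntegrable_const
    rw [Filter.EventuallyLE, ← restrict_Ioo_eq_restrict_Icc, ae_restrict_iff' measurableSet_Ioo]
    filter_upwards [hd, hVt.ae_differentiableAt] with s hs hsd hst
    have hsT : s ∈ Ioo 0 T := ⟨hst.1, hst.2.trans_le ht.2⟩
    have hsd' := hsd (by rw [uIcc_of_le ht.1]; exact Ioo_subset_Icc_self hst)
    have hexp : HasDerivAt (fun s : ℝ => Real.exp (-(k * s))) (Real.exp (-(k * s)) * -(k * 1)) s :=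
      (((hasDerivAt_id s).const_mul k).neg).exp
    have hprod : deriv (fun s => V s * Real.exp (-(k * s))) s = _ :=
      (hsd'.hasDerivAt.mul hexp).deriv
    rw [hprod]
    have h1 := hs hsT
    have h2 : Real.exp (-(k * s)) ≤ 1 := by
      rw [Real.exp_le_one_iff]
      have := mul_nonneg hk hst.1.le
      linarith
    have h3 := Real.exp_pos (-(k * s))
    calc deriv V s * Real.exp (-(k * s)) + V s * (Real.exp (-(k * s)) * -(k * 1))
        = (deriv V s - k * V s) * Real.exp (-(k * s)) := by ring
      _ ≤ η * Real.exp (-(k * s)) := by gcongr; linarith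
      _ ≤ η * 1 := by gcongr
      _ = η := mul_one η
  rw [hint] at hle
  simp only [h0, zero_mul, sub_zero, intervalIntegral.integral_const, smul_eq_mul] at hle
  calc V t = V t * Real.exp (-(k * t)) * Real.exp (k * t) := by
        rw [mul_assoc, ← Real.exp_add]; simp
    _ ≤ t * η * Real.exp (k * t) := by gcongr
    _ = η * t * Real.exp (k * t) := by ring

section Comparison

variable {E : Type*} [NormedAddCommGroup E] [InnerProductSpace ℝ E] [FiniteDimensional ℝ E]
  {m : ℕ}

/-- Two trajectories of `F - β s` whose controls `s`, `s'` are monotone up to `η` remain close to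
each other when `Q` is a positive definite operator with `Q β = γᵀ`. -/
lemma norm_sq_le_of_monotone {F : ℝ → E → E} {L : ℝ≥0} {T : ℝ}
    (hF : ∀ t, LipschitzWith L (F t)) (β : (Fin m → ℝ) →L[ℝ] E) (γ : E →L[ℝ] (Fin m → ℝ))
    (Q : E →L[ℝ] E) (hsymm : ∀ x y, inner ℝ (Q x) y = inner ℝ x (Q y)) {c : ℝ} (hc : 0 < c)
    (hpos : ∀ z, c * ‖z‖ ^ 2 ≤ inner ℝ (Q z) z)
    (hβγ : ∀ z s, inner ℝ (Q z) (β s) = ∑ i, s i * γ z i) {η : ℝ} (hη : 0 ≤ η)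
    {x y : ℝ → E} (hx : AbsolutelyContinuousOnInterval x 0 T)
    (hy : AbsolutelyContinuousOnInterval y 0 T) (h0 : x 0 = y 0)
    (hd : ∀ᵐ t, t ∈ Ioo 0 T → ∃ s s' : Fin m → ℝ, HasDerivAt x (F t (x t) - β s) t ∧
      HasDerivAt y (F t (y t) - β s') t ∧ -η ≤ ∑ i, (s i - s' i) * γ (x t - y t) i) :
    ∀ t ∈ Icc 0 T, c * ‖x t - y t‖ ^ 2 ≤
      2 * η * t * Real.exp (2 * (‖Q‖ * L / c) * t) := by
  have hz : AbsolutelyContinuousOnInterval (fun t => x t - y t) 0 T := hx.sub hy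
  -- The quadratic form is Lipschitz only on bounded sets, so the path is first confined to a ball.
  obtain ⟨R, hR⟩ := hz.exists_bound
  have hsm : ContDiff ℝ 1 fun z : E => inner ℝ (Q z) z := Q.contDiff.inner ℝ contDiff_id
  obtain ⟨K, hK⟩ := (hsm.contDiffOn (s := Metric.closedBall 0 R)).exists_lipschitzOnWith
    (by simp) (convex_closedBall _ _) (isCompact_closedBall _ _)
  have hV := absolutelyContinuousOnInterval_comp_lipschitzOnWith hz hK
    (fun t ht => by simpa using hR t ht)
  intro t ht
  refine (hpos _).trans (le_mul_exp_of_absolutelyContinuous (by positivity) (by positivity) hV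
    (by simp [h0]) ?_ t ht)
  filter_upwards [hd] with t hdt htT
  obtain ⟨s, s', hxs, hys, hmon⟩ := hdt htT
  have hzd := hxs.sub hys
  have hVd := ((Q.hasFDerivAt.comp_hasDerivAt t hzd).inner ℝ hzd).deriv
  simp only [Function.comp_def, Pi.sub_apply] at hVd
  -- By symmetry `V' = 2⟨Q z, z'⟩`: the `F` part costs at most `2(‖Q‖L/c) V`, the control part at
  -- most `2η`.
  rw [hVd, hsymm (F t (x t) - β s - (F t (y t) - β s')), real_inner_comm (Q (x t - y t))]
  set z := x t - y t with hzdef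
  have e : F t (x t) - β s - (F t (y t) - β s') = (F t (x t) - F t (y t)) - β (s - s') := by
    rw [map_sub]; abel
  have h1 : inner ℝ (Q z) (F t (x t) - F t (y t)) ≤ ‖Q‖ * L * ‖z‖ ^ 2 := by
    calc inner ℝ (Q z) (F t (x t) - F t (y t)) ≤ ‖Q z‖ * ‖F t (x t) - F t (y t)‖ :=
          real_inner_le_norm _ _
      _ ≤ (‖Q‖ * ‖z‖) * (L * ‖z‖) := by
          gcongr
          · exact Q.le_opNorm z
          · exact (hF t).norm_sub_le _ _
      _ = _ := by ring
  have h2 : ‖Q‖ * L * ‖z‖ ^ 2 ≤ ‖Q‖ * L / c * inner ℝ (Q z) z := by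
    calc ‖Q‖ * L * ‖z‖ ^ 2 = ‖Q‖ * L / c * (c * ‖z‖ ^ 2) := by field_simp
      _ ≤ _ := by gcongr; exact hpos z
  rw [e, inner_sub_right, hβγ]
  simp only [Pi.sub_apply]
  linarith

end Comparison

/-! ### Global solutions of Lipschitz equations -/

/-- The truncation of a real number to `[-R,R]`. -/
noncomputable def clip (R r : ℝ) : ℝ := max (-R) (min R r)

lemma abs_clip_sub_le (R r r' : ℝ) : |clip R r - clip R r'| ≤ |r - r'| :=
  (abs_max_sub_max_le_max _ _ _ _).trans
    (by simpa using abs_min_sub_min_le_max R r R r')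

lemma abs_clip_le {R : ℝ} (hR : 0 ≤ R) (r : ℝ) : |clip R r| ≤ R :=
  abs_le.2 ⟨le_max_left _ _, max_le (by linarith) (min_le_left _ _)⟩

lemma clip_of_abs_le {R r : ℝ} (h : |r| ≤ R) : clip R r = r := by
  rw [clip, min_eq_right (abs_le.1 h).2, max_eq_right (abs_le.1 h).1]

/-- There are bounded `1`-Lipschitz maps which fix a given ball. -/
lemma exists_bounded_lipschitzWith_one {n : ℕ} {R : ℝ} (hR : 0 ≤ R) :
    ∃ ρ : EuclideanSpace ℝ (Fin n) → EuclideanSpace ℝ (Fin n), LipschitzWith 1 ρ ∧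
      (∀ x, ‖x‖ ≤ R → ρ x = x) ∧ ∃ N, 0 ≤ N ∧ ∀ x, ‖ρ x‖ ≤ N := by
  refine ⟨fun x => WithLp.toLp 2 fun i => clip R (x i), LipschitzWith.of_dist_le_mul fun x y => ?_,
    fun x hx => ?_, √(∑ _ : Fin n, R ^ 2), Real.sqrt_nonneg _, fun x => ?_⟩
  · rw [EuclideanSpace.dist_eq, EuclideanSpace.dist_eq, NNReal.coe_one, one_mul]
    apply Real.sqrt_le_sqrt
    refine Finset.sum_le_sum fun i _ => ?_
    gcongr
    exact abs_clip_sub_le R _ _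
  · ext i
    exact clip_of_abs_le ((PiLp.norm_apply_le x i).trans hx)
  · rw [EuclideanSpace.norm_eq]
    apply Real.sqrt_le_sqrt
    refine Finset.sum_le_sum fun i _ => ?_
    gcongr
    exact abs_clip_le hR _

/-- Global existence of a solution of an ordinary differential equation with a Lipschitz
right-hand side; the Lipschitz constant of the solution depends only on the linear growth of the
right-hand side. -/
lemma exists_lipschitzWith_hasDerivAt {n : ℕ} {T : ℝ} (hT : 0 < T)
    {G : ℝ → EuclideanSpace ℝ (Fin n) → EuclideanSpace ℝ (Fin n)} {K A M : ℝ≥0}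
    (hc : ∀ x, Continuous fun t => G t x) (hl : ∀ t, LipschitzWith K (G t))
    (hg : ∀ t ∈ Icc 0 T, ∀ x, ‖G t x‖ ≤ A * ‖x‖ + M) (x₀ : EuclideanSpace ℝ (Fin n)) :
    ∃ x : ℝ → EuclideanSpace ℝ (Fin n),
      LipschitzWith (A * (gronwallBound ‖x₀‖ A M T).toNNReal + M) x ∧ x 0 = x₀ ∧
      ∀ t ∈ Ioo 0 T, HasDerivAt x (G t (x t)) t := by
  set R := gronwallBound ‖x₀‖ A M T with hRdef
  have hmono : Monotone (gronwallBound ‖x₀‖ A M) :=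
    gronwallBound_mono (norm_nonneg _) M.2 A.2
  have hR : 0 ≤ R := by
    have := hmono hT.le
    rw [gronwallBound_x0] at this
    exact (norm_nonneg _).trans this
  -- Truncating the space variable bounds the field, so Picard–Lindelöf covers all of `[0,T]`. Since
  -- `‖ρ x‖ ≤ ‖x‖`, the growth bound survives and Grönwall keeps the solution in the ball where `ρ`
  -- is the identity.
  obtain ⟨ρ, hρ, hρe, N, hN, hρN⟩ := exists_bounded_lipschitzWith_one (n := n) hR
  have hρ0 : ρ 0 = 0 := hρe 0 (by simpa using hR)
  have hρle : ∀ x, ‖ρ x‖ ≤ ‖x‖ := fun x => by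
    simpa [hρ0] using hρ.norm_sub_le x 0
  lift N to ℝ≥0 using hN
  have hpl : IsPicardLindelof (fun t x => G t (ρ x)) (⟨0, left_mem_Icc.2 hT.le⟩ : Icc 0 T) x₀
      ((A * N + M) * T.toNNReal) 0 (A * N + M) (K * 1) :=
    { lipschitzOnWith := fun t _ => ((hl t).comp hρ).lipschitzOnWith
      continuousOn := fun x _ => (hc (ρ x)).continuousOn
      norm_le := fun t ht x _ => by
        refine (hg t ht (ρ x)).trans ?_
        push_cast
        gcongr
        exact hρN x
      mul_max_le := by
        simp [hT.le] }
  obtain ⟨α, hα0, hα⟩ := hpl.exists_eq_forall_mem_Icc_hasDerivWithinAt₀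
  have hαc : ContinuousOn α (Icc 0 T) := fun t ht => (hα t ht).continuousWithinAt
  have hbd : ∀ t ∈ Icc 0 T, ‖α t‖ ≤ R := by
    intro t ht
    have := norm_le_gronwallBound_of_norm_deriv_right_le (δ := ‖x₀‖) (K := A) (ε := M) hαc
      (fun s hs => (hα s (Ico_subset_Icc_self hs)).mono_of_mem_nhdsWithin
        (Icc_mem_nhdsGE_of_mem hs)) (by rw [hα0])
      (fun s hs => (hg s (Ico_subset_Icc_self hs) _).trans (by gcongr; exact hρle _)) t ht
    exact this.trans (hmono (by linarith [ht.2]))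
  have hα' : ∀ t ∈ Icc 0 T, HasDerivWithinAt α (G t (α t)) (Icc 0 T) t := fun t ht => by
    simpa [hρe _ (hbd t ht)] using hα t ht
  have hlip : LipschitzOnWith (A * R.toNNReal + M) α (Icc 0 T) := by
    refine (convex_Icc 0 T).lipschitzOnWith_of_nnnorm_hasDerivWithin_le hα' fun t ht => ?_
    rw [← NNReal.coe_le_coe, coe_nnnorm]
    push_cast
    rw [Real.coe_toNNReal R hR]
    refine (hg t ht _).trans ?_
    gcongr
    exact hbd t ht
  refine ⟨fun t => α (projIcc 0 T hT.le t), ?_, ?_, ?_⟩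
  · have h := hlip.to_restrict.comp (LipschitzWith.projIcc hT.le)
    rwa [mul_one] at h
  · simp only [projIcc_left]
    exact hα0
  · intro t ht
    have htI := Ioo_subset_Icc_self ht
    have h1 : HasDerivAt α (G t (α t)) t := (hα' t htI).hasDerivAt (Icc_mem_nhds ht.1 ht.2)
    simp only [projIcc_of_mem hT.le htI]
    refine h1.congr_of_eventuallyEq ?_
    filter_upwards [Icc_mem_nhds ht.1 ht.2] with s hs
    rw [projIcc_of_mem hT.le hs]

/-! ### The multivalued sign and its Yosida approximation -/

lemma abs_le_one_of_mem_sgn {ξ s : ℝ} (h : s ∈ sgn ξ) : |s| ≤ 1 := by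
  rcases h with ⟨_, rfl⟩ | ⟨_, rfl⟩ | ⟨_, h⟩
  · simp
  · simp
  · exact abs_le.2 h

/-- A sign of `ξ` maximizes `q ↦ q ξ` over `[-1,1]`; adding two such inequalities gives
monotonicity. -/
lemma sub_mul_nonneg_of_mem_sgn {ξ s q : ℝ} (h : s ∈ sgn ξ) (hq : |q| ≤ 1) :
    0 ≤ (s - q) * ξ := by
  obtain ⟨h1, h2⟩ := abs_le.1 hq
  rcases h with ⟨h, rfl⟩ | ⟨h, rfl⟩ | ⟨rfl, h⟩
  · exact mul_nonneg (by linarith) h.le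
  · exact mul_nonneg_of_nonpos_of_nonpos (by linarith) h.le
  · simp

/-- The multivalued sign is monotone. -/
lemma sgn_monotone {ξ ξ' s s' : ℝ} (h : s ∈ sgn ξ) (h' : s' ∈ sgn ξ') :
    0 ≤ (s - s') * (ξ - ξ') := by
  have h1 := sub_mul_nonneg_of_mem_sgn h (abs_le_one_of_mem_sgn h')
  have h2 := sub_mul_nonneg_of_mem_sgn h' (abs_le_one_of_mem_sgn h)
  linarith

/-- The truncation at slope `l` is the Yosida approximation of the multivalued sign. -/
lemma clip_mem_sgn {l : ℝ} (hl : 0 < l) (ξ : ℝ) :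
    clip 1 (l * ξ) ∈ sgn (ξ - clip 1 (l * ξ) / l) := by
  have e : ∀ r, ξ - r / l = (l * ξ - r) / l := fun r => by field_simp
  rcases lt_or_ge 1 (l * ξ) with h | h
  · left
    have : clip 1 (l * ξ) = 1 := by rw [clip, min_eq_left h.le]; norm_num
    rw [this, e]
    exact ⟨div_pos (by linarith) hl, rfl⟩
  rcases lt_or_ge (l * ξ) (-1) with h' | h'
  · right; left
    have : clip 1 (l * ξ) = -1 := by rw [clip, min_eq_right h, max_eq_left h'.le]
    rw [this, e]
    exact ⟨div_neg_of_neg_of_pos (by linarith) hl, rfl⟩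
  · right; right
    rw [clip_of_abs_le (abs_le.2 ⟨h', h⟩), e]
    exact ⟨by simp, h', h⟩

/-- Each truncation is an exact sign at the shifted point `ξ - p / l`, where monotonicity holds
exactly. The shifts contribute `(p - q)(p / l - q / l')`, with `|p - q| ≤ 2`. -/
lemma clip_almost_monotone {l l' : ℝ} (hl : 0 < l) (hl' : 0 < l') (ξ ξ' : ℝ) :
    -(2 * (1 / l + 1 / l')) ≤ (clip 1 (l * ξ) - clip 1 (l' * ξ')) * (ξ - ξ') := by
  have h := sgn_monotone (clip_mem_sgn hl ξ) (clip_mem_sgn hl' ξ')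
  have hp := abs_clip_le zero_le_one (l * ξ)
  have hq := abs_clip_le zero_le_one (l' * ξ')
  set p := clip 1 (l * ξ)
  set q := clip 1 (l' * ξ')
  have h1 : |(p - q) * (p / l - q / l')| ≤ 2 * (1 / l + 1 / l') := by
    rw [abs_mul]
    gcongr
    · exact (abs_sub p q).trans (by linarith)
    · refine (abs_sub _ _).trans ?_
      rw [abs_div, abs_div, abs_of_pos hl, abs_of_pos hl']
      gcongr
  have h2 := (abs_le.1 h1).1
  have e : (p - q) * (ξ - ξ') =
      (p - q) * (ξ - p / l - (ξ' - q / l')) + (p - q) * (p / l - q / l') := by ring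
  linarith

lemma exists_sgn_eq_Icc (ξ : ℝ) : ∃ a b, sgn ξ = Icc a b := by
  rcases lt_trichotomy ξ 0 with h | rfl | h
  · refine ⟨-1, -1, ?_⟩
    ext s
    simp [sgn, h, h.ne, h.not_gt]
  · refine ⟨-1, 1, ?_⟩
    ext s
    simp [sgn]
  · refine ⟨1, 1, ?_⟩
    ext s
    simp [sgn, h, h.ne', h.not_gt]

/-- As an order interval, this set is visibly compact and convex, which the limit argument requires.
-/
lemma exists_Sgn_eq_Icc {m : ℕ} (y : Fin m → ℝ) : ∃ a b, Sgn y = Icc a b := by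
  choose a b h using exists_sgn_eq_Icc
  refine ⟨fun i => a (y i), fun i => b (y i), ?_⟩
  ext s
  simp only [Sgn, mem_ofPred_eq, h, mem_Icc, Pi.le_def, forall_and]

/-! ### Derivatives of limits -/

/-- The derivative of a limit of functions whose derivatives are eventually close to a closed convex
set, in the sense of support functions, belongs to this set. -/
lemma mem_of_hasDerivAt_of_tendsto {E : Type*} [NormedAddCommGroup E] [NormedSpace ℝ E]
    {X : ℕ → ℝ → E} {x : ℝ → E} {t : ℝ} {x' : E} {K : Set E} (hK : Convex ℝ K)
    (hKc : IsClosed K) (hlim : ∀ᶠ τ in 𝓝 t, Tendsto (fun k => X k τ) atTop (𝓝 (x τ)))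
    (hX : ∀ (l : E →L[ℝ] ℝ) (u : ℝ), (∀ q ∈ K, l q < u) →
      ∀ᶠ p : ℕ × ℝ in atTop ×ˢ 𝓝 t, ∃ v, HasDerivAt (X p.1) v p.2 ∧ l v ≤ u)
    (hx : HasDerivAt x x' t) : x' ∈ K := by
  by_contra hn
  -- Here `l < u` on `K` but `u < l x'`. The mean value inequality bounds the slopes of `l ∘ X k`
  -- near `t` by `u`; the bound passes to the right slopes of `l ∘ x` at `t`, a contradiction.
  obtain ⟨l, u, hl, hu⟩ := geometric_hahn_banach_closed_point hK hKc hn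
  obtain ⟨pa, ha, pb, hb, hab⟩ := eventually_prod_iff.1 (hX l u hl)
  obtain ⟨r, hr, hball⟩ := Metric.eventually_nhds_iff_ball.1 (hb.and hlim)
  have hslope : ∀ τ ∈ Ioo t (t + r), slope (fun s => l (x s)) t τ ≤ u := by
    intro τ hτ
    have hin : ∀ s ∈ Icc t τ, s ∈ Metric.ball t r := fun s hs => by
      rw [Metric.mem_ball, Real.dist_eq, abs_lt]
      constructor <;> linarith [hs.1, hs.2, hτ.2]
    have hk : ∀ᶠ k in atTop, l (X k τ) - l (X k t) ≤ u * (τ - t) := by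
      filter_upwards [ha] with k hk
      have hd : ∀ s ∈ Icc t τ, ∃ v, HasDerivAt (fun s => l (X k s)) v s ∧ v ≤ u := by
        intro s hs
        obtain ⟨v, hv, hvu⟩ := hab hk (hball s (hin s hs)).1
        exact ⟨l v, l.hasFDerivAt.comp_hasDerivAt s hv, hvu⟩
      refine (convex_Icc t τ).image_sub_le_mul_sub_of_deriv_le (f := fun s => l (X k s))
        (fun s hs => ?_) (fun s hs => ?_) (fun s hs => ?_) t (left_mem_Icc.2 hτ.1.le) τ
        (right_mem_Icc.2 hτ.1.le) hτ.1.le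
      · obtain ⟨v, hv, _⟩ := hd s hs
        exact hv.continuousAt.continuousWithinAt
      · obtain ⟨v, hv, _⟩ := hd s (interior_subset hs)
        exact hv.differentiableAt.differentiableWithinAt
      · obtain ⟨v, hv, hvu⟩ := hd s (interior_subset hs)
        rwa [hv.deriv]
    have ht1 := (hball τ (hin τ (right_mem_Icc.2 hτ.1.le))).2
    have ht2 := (hball t (hin t (left_mem_Icc.2 hτ.1.le))).2
    have h3 := le_of_tendsto (((l.continuous.tendsto _).comp ht1).sub
      ((l.continuous.tendsto _).comp ht2)) hk
    rw [slope_def_field, div_le_iff₀ (by linarith [hτ.1])]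
    exact h3
  have hd : HasDerivAt (fun s => l (x s)) (l x') t := l.hasFDerivAt.comp_hasDerivAt t hx
  have h4 := (hasDerivWithinAt_iff_tendsto_slope' (s := Ioi t) (by simp)).1 hd.hasDerivWithinAt
  have h5 : l x' ≤ u := le_of_tendsto h4 <| by
    filter_upwards [Ioo_mem_nhdsGT (show t < t + r by linarith)] with τ hτ using hslope τ hτ
  linarith

/-! ### Existence by regularization -/

section Existence

variable {n m : ℕ}

/-- The regularized control: the Yosida approximation of `Sgn` at `γ x + D`. -/
noncomputable def control (γ : EuclideanSpace ℝ (Fin n) →L[ℝ] (Fin m → ℝ)) (D : Fin m → ℝ)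
    (k : ℕ) (x : EuclideanSpace ℝ (Fin n)) : Fin m → ℝ :=
  fun i => clip 1 (((k : ℝ) + 1) * (γ x i + D i))

/-- This bound is independent of `k`, unlike the Lipschitz constant of the control. -/
lemma norm_control_le (γ : EuclideanSpace ℝ (Fin n) →L[ℝ] (Fin m → ℝ)) (D : Fin m → ℝ) (k : ℕ)
    (x : EuclideanSpace ℝ (Fin n)) : ‖control γ D k x‖ ≤ 1 :=
  (pi_norm_le_iff_of_nonneg zero_le_one).2 fun _ => abs_clip_le zero_le_one _

lemma lipschitzWith_control (γ : EuclideanSpace ℝ (Fin n) →L[ℝ] (Fin m → ℝ)) (D : Fin m → ℝ)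
    (k : ℕ) : LipschitzWith (((k : ℝ≥0) + 1) * ‖γ‖₊) (control γ D k) := by
  refine LipschitzWith.of_dist_le_mul fun x y => (dist_pi_le_iff (by positivity)).2 fun i => ?_
  refine (abs_clip_sub_le 1 _ _).trans ?_
  rw [← mul_sub, add_sub_add_right_eq_sub, abs_mul, abs_of_nonneg (by positivity), dist_eq_norm]
  push_cast
  rw [mul_assoc]
  gcongr
  have h1 : ‖γ (x - y) i‖ ≤ ‖γ (x - y)‖ := norm_le_pi_norm _ i
  rw [map_sub, Pi.sub_apply] at h1
  refine (h1.trans ?_)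
  rw [← map_sub]
  exact γ.le_opNorm _

/-- Near a limit point the regularized controls belong to the value of `Sgn` at this point. -/
lemma eventually_control_mem_Sgn {γ : EuclideanSpace ℝ (Fin n) →L[ℝ] (Fin m → ℝ)} {D : Fin m → ℝ}
    {ι : Type*} {f : Filter ι} {k : ι → ℕ} {X : ι → EuclideanSpace ℝ (Fin n)}
    {x : EuclideanSpace ℝ (Fin n)} (hk : Tendsto k f atTop) (hX : Tendsto X f (𝓝 x)) :
    ∀ᶠ p in f, control γ D (k p) (X p) ∈ Sgn (γ x + D) := by
  simp only [Sgn, mem_ofPred_eq]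
  rw [eventually_all]
  intro i
  have hk' : Tendsto (fun p => (k p : ℝ) + 1) f atTop :=
    tendsto_atTop_add_const_right _ _ (tendsto_natCast_atTop_atTop.comp hk)
  have hy : Tendsto (fun p => γ (X p) i + D i) f (𝓝 (γ x i + D i)) :=
    (((continuous_apply i).comp γ.continuous).tendsto x |>.comp hX).add tendsto_const_nhds
  rcases lt_trichotomy (γ x i + D i) 0 with h | h | h
  -- Away from zero the growing slope saturates the truncation; at zero every value in `[-1,1]` is
  -- allowed.
  · filter_upwards [(hk'.atTop_mul_neg h hy).eventually_le_atBot (-1)] with p hp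
    right; left
    refine ⟨h, ?_⟩
    rw [control, clip, min_eq_right (by linarith), max_eq_left hp]
  · refine Eventually.of_forall fun p => ?_
    right; right
    exact ⟨h, abs_le.1 (abs_clip_le zero_le_one _)⟩
  · filter_upwards [(hk'.atTop_mul_pos h hy).eventually_ge_atTop 1] with p hp
    left
    refine ⟨h, ?_⟩
    rw [control, clip, min_eq_left hp]
    norm_num

variable {F : ℝ → EuclideanSpace ℝ (Fin n) → EuclideanSpace ℝ (Fin n)} {L : ℝ≥0} {T : ℝ}

/-- The regularized equations have uniformly Lipschitz solutions. -/
lemma exists_regularized_solution (hT : 0 < T) (hFc : ∀ x, Continuous fun t => F t x)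
    (hF : ∀ t, LipschitzWith L (F t)) (β : (Fin m → ℝ) →L[ℝ] EuclideanSpace ℝ (Fin n))
    (γ : EuclideanSpace ℝ (Fin n) →L[ℝ] (Fin m → ℝ)) (D : Fin m → ℝ)
    (x₀ : EuclideanSpace ℝ (Fin n)) :
    ∃ (K : ℝ≥0) (X : ℕ → ℝ → EuclideanSpace ℝ (Fin n)), ∀ k, LipschitzWith K (X k) ∧ X k 0 = x₀ ∧
      ∀ t ∈ Ioo 0 T, HasDerivAt (X k) (F t (X k t) - β (control γ D k (X k t))) t := by
  obtain ⟨M, hM⟩ := (isCompact_Icc (a := 0) (b := T)).exists_bound_of_continuousOn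
    (hFc 0).continuousOn
  have hM0 : 0 ≤ M := (norm_nonneg _).trans (hM 0 (left_mem_Icc.2 hT.le))
  lift M to ℝ≥0 using hM0
  -- Only `K` depends on `k`; the growth constants `A` and `M`, which control the Lipschitz constant
  -- of the solution, do not.
  have key := fun k : ℕ => exists_lipschitzWith_hasDerivAt (K := L + ‖β‖₊ * ((k + 1) * ‖γ‖₊))
    (A := L) (M := M + ‖β‖₊) (G := fun t x => F t x - β (control γ D k x)) hT
    (fun x => (hFc x).sub continuous_const)
    (fun t => (hF t).sub (β.lipschitz.comp (lipschitzWith_control γ D k)))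
    (fun t ht x => by
      have h1 := hM t ht
      have h2 := (hF t).norm_sub_le x 0
      have h3 : ‖F t x‖ ≤ ‖F t x - F t 0‖ + ‖F t 0‖ := by
        simpa using norm_add_le (F t x - F t 0) (F t 0)
      have h4 : ‖β (control γ D k x)‖ ≤ ‖β‖ :=
        β.unit_le_opNorm _ (norm_control_le γ D k x)
      rw [sub_zero] at h2
      push_cast
      linarith [norm_sub_le (F t x) (β (control γ D k x))]) x₀
  choose X hX using key
  exact ⟨_, X, hX⟩

/-- Two solutions of the regularized equations are close to each other. -/
lemma norm_sq_sub_regularized_le {β : (Fin m → ℝ) →L[ℝ] EuclideanSpace ℝ (Fin n)}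
    {γ : EuclideanSpace ℝ (Fin n) →L[ℝ] (Fin m → ℝ)} {D : Fin m → ℝ} (hT : 0 < T)
    (hF : ∀ t, LipschitzWith L (F t))
    (Q : EuclideanSpace ℝ (Fin n) →L[ℝ] EuclideanSpace ℝ (Fin n))
    (hsymm : ∀ x y, inner ℝ (Q x) y = inner ℝ x (Q y)) {c : ℝ} (hc : 0 < c)
    (hpos : ∀ z, c * ‖z‖ ^ 2 ≤ inner ℝ (Q z) z)
    (hβγ : ∀ z s, inner ℝ (Q z) (β s) = ∑ i, s i * γ z i) {K : ℝ≥0}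
    {x₀ : EuclideanSpace ℝ (Fin n)} {X : ℕ → ℝ → EuclideanSpace ℝ (Fin n)}
    (hX : ∀ k, LipschitzWith K (X k) ∧ X k 0 = x₀ ∧
      ∀ t ∈ Ioo 0 T, HasDerivAt (X k) (F t (X k t) - β (control γ D k (X k t))) t) :
    ∃ A : ℝ, 0 ≤ A ∧ ∀ k l, ∀ t ∈ Icc 0 T,
      ‖X k t - X l t‖ ^ 2 ≤ A * (1 / ((k : ℝ) + 1) + 1 / ((l : ℝ) + 1)) := by
  refine ⟨4 * m * T * Real.exp (2 * (‖Q‖ * L / c) * T) / c, by positivity, fun k l t ht => ?_⟩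
  have hη : 0 ≤ (m : ℝ) * (2 * (1 / ((k : ℝ) + 1) + 1 / ((l : ℝ) + 1))) := by positivity
  have h := norm_sq_le_of_monotone (T := T) hF β γ Q hsymm hc hpos hβγ hη
    (x := X k) (y := X l)
    (hX k).1.lipschitzOnWith.absolutelyContinuousOnInterval
    (hX l).1.lipschitzOnWith.absolutelyContinuousOnInterval
    ((hX k).2.1.trans (hX l).2.1.symm) (Eventually.of_forall fun s hs =>
      ⟨_, _, (hX k).2.2 s hs, (hX l).2.2 s hs, by
        have hsum := Finset.sum_le_sum fun i (_ : i ∈ Finset.univ) =>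
          clip_almost_monotone (l := (k : ℝ) + 1) (l' := (l : ℝ) + 1) (by positivity)
            (by positivity) (γ (X k s) i + D i) (γ (X l s) i + D i)
        simp only [Finset.sum_const, Finset.card_univ, Fintype.card_fin, nsmul_eq_mul,
          add_sub_add_right_eq_sub] at hsum
        simpa only [map_sub, Pi.sub_apply, control, mul_neg] using hsum⟩) t ht
  rw [div_mul_eq_mul_div, le_div_iff₀ hc, mul_comm]
  refine h.trans ?_
  calc 2 * (m * (2 * (1 / ((k : ℝ) + 1) + 1 / ((l : ℝ) + 1)))) * t *
        Real.exp (2 * (‖Q‖ * L / c) * t)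
      ≤ 2 * (m * (2 * (1 / ((k : ℝ) + 1) + 1 / ((l : ℝ) + 1)))) * T *
        Real.exp (2 * (‖Q‖ * L / c) * T) := by
        gcongr
        · exact ht.2
        · exact ht.2
    _ = _ := by ring

/-- Functions on `[0,T]` which form a Cauchy sequence for the uniform distance, with a common
Lipschitz constant, have a Lipschitz uniform limit. -/
lemma exists_lipschitzWith_uniform_limit {E : Type*} [NormedAddCommGroup E] [CompleteSpace E]
    (hT : 0 < T) {K : ℝ≥0} {X : ℕ → ℝ → E} (hX : ∀ k, LipschitzWith K (X k)) {A : ℝ} (hA : 0 ≤ A)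
    (hC : ∀ k l, ∀ t ∈ Icc 0 T,
      ‖X k t - X l t‖ ^ 2 ≤ A * (1 / ((k : ℝ) + 1) + 1 / ((l : ℝ) + 1))) :
    ∃ x : ℝ → E, LipschitzWith K x ∧ ∃ e : ℕ → ℝ, Tendsto e atTop (𝓝 0) ∧
      ∀ k, ∀ t ∈ Icc 0 T, dist (X k t) (x t) ≤ e k := by
  have he : Tendsto (fun N : ℕ => √(A * (1 / ((N : ℝ) + 1) + 1 / ((N : ℝ) + 1)))) atTop (𝓝 0) := by
    have h1 := tendsto_one_div_add_atTop_nhds_zero_nat (𝕜 := ℝ)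
    have h2 := ((h1.add h1).const_mul A).sqrt
    simpa using h2
  have hd : ∀ t ∈ Icc 0 T, ∀ k l N : ℕ, N ≤ k → N ≤ l →
      dist (X k t) (X l t) ≤ √(A * (1 / ((N : ℝ) + 1) + 1 / ((N : ℝ) + 1))) := by
    intro t ht k l N hk hl
    rw [dist_eq_norm]
    apply Real.le_sqrt_of_sq_le
    refine (hC k l t ht).trans ?_
    gcongr
  have hlim : ∀ t ∈ Icc 0 T, ∃ y, Tendsto (fun k => X k t) atTop (𝓝 y) := fun t ht =>
    cauchySeq_tendsto_of_complete (cauchySeq_of_le_tendsto_0 _ (hd t ht) he)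
  choose! y hy using hlim
  have hyl : LipschitzOnWith K y (Icc 0 T) := LipschitzOnWith.of_dist_le_mul fun s hs t ht =>
    le_of_tendsto ((hy s hs).dist (hy t ht)) (Eventually.of_forall fun k => (hX k).dist_le_mul s t)
  refine ⟨fun t => y (projIcc 0 T hT.le t), ?_, _, he, fun k t ht => ?_⟩
  · have h := hyl.to_restrict.comp (LipschitzWith.projIcc hT.le)
    rwa [mul_one] at h
  · simp only [projIcc_of_mem hT.le ht]
    refine le_of_tendsto (tendsto_const_nhds.dist (hy t ht)) ?_
    filter_upwards [eventually_ge_atTop k] with l hl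
    exact hd t ht k l k le_rfl hl

/-- Existence of a Lipschitz solution of the inclusion `x' ∈ F - β Sgn(γ x + D)`. -/
lemma exists_lipschitzWith_solution (hT : 0 < T) (hFc : ∀ x, Continuous fun t => F t x)
    (hF : ∀ t, LipschitzWith L (F t)) (β : (Fin m → ℝ) →L[ℝ] EuclideanSpace ℝ (Fin n))
    (γ : EuclideanSpace ℝ (Fin n) →L[ℝ] (Fin m → ℝ)) (D : Fin m → ℝ)
    (Q : EuclideanSpace ℝ (Fin n) →L[ℝ] EuclideanSpace ℝ (Fin n))
    (hsymm : ∀ x y, inner ℝ (Q x) y = inner ℝ x (Q y)) {c : ℝ} (hc : 0 < c)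
    (hpos : ∀ z, c * ‖z‖ ^ 2 ≤ inner ℝ (Q z) z)
    (hβγ : ∀ z s, inner ℝ (Q z) (β s) = ∑ i, s i * γ z i) (x₀ : EuclideanSpace ℝ (Fin n)) :
    ∃ (K : ℝ≥0) (x : ℝ → EuclideanSpace ℝ (Fin n)), LipschitzWith K x ∧ x 0 = x₀ ∧
      ∀ᵐ t, t ∈ Ioo 0 T → ∃ s ∈ Sgn (γ (x t) + D), HasDerivAt x (F t (x t) - β s) t := by
  obtain ⟨K, X, hX⟩ := exists_regularized_solution hT hFc hF β γ D x₀
  obtain ⟨A, hA, hC⟩ := norm_sq_sub_regularized_le hT hF Q hsymm hc hpos hβγ hX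
  obtain ⟨x, hx, e, he, hxe⟩ := exists_lipschitzWith_uniform_limit hT (fun k => (hX k).1) hA hC
  have hlim : ∀ t ∈ Icc 0 T, Tendsto (fun k => X k t) atTop (𝓝 (x t)) := fun t ht =>
    tendsto_iff_dist_tendsto_zero.2 (squeeze_zero (fun _ => dist_nonneg) (fun k => hxe k t ht) he)
  refine ⟨K, x, hx, ?_, ?_⟩
  · refine tendsto_nhds_unique (hlim 0 (left_mem_Icc.2 hT.le)) ?_
    simp only [(hX _).2.1]
    exact tendsto_const_nhds
  filter_upwards [hx.ae_differentiableAt_real] with t hdt htT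
  have hnhds := Ioo_mem_nhds htT.1 htT.2
  -- Convergence is joint in index and time, since the limit criterion looks at all times near `t`.
  have hXt : Tendsto (fun p : ℕ × ℝ => X p.1 p.2) (atTop ×ˢ 𝓝 t) (𝓝 (x t)) := by
    have h1 : Tendsto (fun p : ℕ × ℝ => x p.2) (atTop ×ˢ 𝓝 t) (𝓝 (x t)) :=
      (hx.continuous.tendsto t).comp tendsto_snd
    refine h1.congr_dist (squeeze_zero' (Eventually.of_forall fun _ => dist_nonneg) ?_
      (he.comp tendsto_fst))
    filter_upwards [tendsto_snd.eventually hnhds] with p hp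
    rw [dist_comm]
    exact hxe _ _ (Ioo_subset_Icc_self hp)
  have hFcont : Continuous fun p : ℝ × EuclideanSpace ℝ (Fin n) => F p.1 p.2 :=
    continuous_prod_of_continuous_lipschitzWith' _ L hF hFc
  have hFt : Tendsto (fun p : ℕ × ℝ => F p.2 (X p.1 p.2)) (atTop ×ˢ 𝓝 t) (𝓝 (F t (x t))) :=
    (hFcont.tendsto (t, x t)).comp (tendsto_snd.prodMk_nhds hXt)
  obtain ⟨a, b, hab⟩ := exists_Sgn_eq_Icc (γ (x t) + D)
  have hcpt : IsCompact ((fun s => F t (x t) - β s) '' Sgn (γ (x t) + D)) := by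
    rw [hab]
    exact isCompact_Icc.image (by fun_prop)
  have hcvx : Convex ℝ ((fun s => F t (x t) - β s) '' Sgn (γ (x t) + D)) := by
    have : (fun s => F t (x t) - β s) '' Sgn (γ (x t) + D) =
        (fun q => F t (x t) + q) '' ((-β) '' Icc a b) := by
      rw [image_image, hab]
      simp [sub_eq_add_neg]
    rw [this]
    exact ((convex_Icc a b).linear_image (-β).toLinearMap).translate _
  have hmem := mem_of_hasDerivAt_of_tendsto hcvx hcpt.isClosed
    (Filter.mem_of_superset hnhds fun τ hτ => hlim τ (Ioo_subset_Icc_self hτ)) ?_ hdt.hasDerivAt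
  · obtain ⟨s, hs, hsd⟩ := hmem
    exact ⟨s, hs, hdt.hasDerivAt.congr_deriv hsd.symm⟩
  intro l u hl
  -- Compactness turns `l < u` into a uniform gap `δ`, which absorbs the variation of `F` near `(t,
  -- x t)`.
  obtain ⟨δ, hδ, hlδ⟩ := hcpt.exists_forall_le' (f := fun q => u - l q) (a := 0)
    (by fun_prop) (fun q hq => sub_pos.2 (hl q hq))
  have hlF : ∀ᶠ p : ℕ × ℝ in atTop ×ˢ 𝓝 t, l (F p.2 (X p.1 p.2)) < l (F t (x t)) + δ :=
    ((l.continuous.tendsto _).comp hFt).eventually_lt_const (by linarith)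
  filter_upwards [hlF, eventually_control_mem_Sgn (γ := γ) (D := D) tendsto_fst hXt,
    tendsto_snd.eventually hnhds] with p h1 h2 h3
  refine ⟨_, (hX p.1).2.2 p.2 h3, ?_⟩
  have h4 := hlδ _ (mem_image_of_mem _ h2)
  simp only [map_sub] at h4 ⊢
  linarith

end Existence

/-! ### From matrices to operators, and the conclusion -/

/-- A positive definite matrix is coercive. -/
lemma exists_coercive_of_posDef {n : ℕ} {P : Matrix (Fin n) (Fin n) ℝ} (hP : P.PosDef) :
    ∃ c : ℝ, 0 < c ∧ ∀ z : EuclideanSpace ℝ (Fin n),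
      c * ‖z‖ ^ 2 ≤ inner ℝ (Matrix.toEuclideanCLM (𝕜 := ℝ) P z) z := by
  have hpos : ∀ z : EuclideanSpace ℝ (Fin n), z ≠ 0 →
      0 < inner ℝ (Matrix.toEuclideanCLM (𝕜 := ℝ) P z) z := by
    intro z hz
    rw [real_inner_comm, Matrix.inner_toEuclideanCLM]
    have := hP.dotProduct_mulVec_pos (x := z.ofLp) (by simpa using hz)
    simpa using this
  obtain ⟨c, hc, h⟩ := (isCompact_sphere (0 : EuclideanSpace ℝ (Fin n)) 1).exists_forall_le'
    (f := fun z => inner ℝ (Matrix.toEuclideanCLM (𝕜 := ℝ) P z) z) (a := 0)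
    (by fun_prop) (fun z hz => hpos z (by rintro rfl; simp at hz))
  refine ⟨c, hc, fun z => ?_⟩
  rcases eq_or_ne z 0 with rfl | hz
  · simp
  have hz' : 0 < ‖z‖ := norm_pos_iff.2 hz
  have h1 := h (‖z‖⁻¹ • z) (by simp [norm_smul, hz'.ne'])
  rw [map_smul, inner_smul_left, inner_smul_right] at h1
  simp only [map_inv₀, conj_trivial] at h1
  calc c * ‖z‖ ^ 2
      ≤ (‖z‖⁻¹ * (‖z‖⁻¹ * inner ℝ (Matrix.toEuclideanCLM (𝕜 := ℝ) P z) z)) * ‖z‖ ^ 2 := by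
        gcongr
    _ = _ := by field_simp

end SlidingMode

theorem mainTheorem3 {n m : ℕ} (T : ℝ) (hT : 0 < T)
    (f : ℝ → EuclideanSpace ℝ (Fin n) → EuclideanSpace ℝ (Fin n))
    (B : Matrix (Fin n) (Fin m) ℝ) (C : Matrix (Fin m) (Fin n) ℝ) (D : Fin m → ℝ)
    (hf_lip : ∃ L : ℝ, 0 ≤ L ∧ ∀ t ∈ Icc 0 T, ∀ x₁ x₂ : EuclideanSpace ℝ (Fin n),
      ‖f t x₁ - f t x₂‖ ≤ L * ‖x₁ - x₂‖)
    (hf_time : SlidingMode.TimeDerivBound T f)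
    (hP : ∃ P : Matrix (Fin n) (Fin n) ℝ, P.PosDef ∧ ∀ i : Fin m, P *ᵥ B.col i = C.row i)
    (x₀ : EuclideanSpace ℝ (Fin n)) :
    ∃ x : ℝ → EuclideanSpace ℝ (Fin n),
      SlidingMode.IsSolution T f B C D x₀ x ∧
      (∃ K : ℝ≥0, LipschitzOnWith K x (Icc 0 T)) ∧
      ∀ y : ℝ → EuclideanSpace ℝ (Fin n),
        SlidingMode.IsSolution T f B C D x₀ y → EqOn y x (Icc 0 T) := by
  obtain ⟨L, hL, hlip⟩ := hf_lip
  lift L to ℝ≥0 using hL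
  obtain ⟨F, hFc, hF, hfF⟩ := SlidingMode.exists_continuous_vectorField hT (L := L)
    (fun t ht => LipschitzWith.of_dist_le_mul fun x y => by
      simpa only [dist_eq_norm] using hlip t ht x y) hf_time
  obtain ⟨P, hPd, hPB⟩ := hP
  obtain ⟨c, hc, hpos⟩ := SlidingMode.exists_coercive_of_posDef hPd
  set Q := Matrix.toEuclideanCLM (𝕜 := ℝ) P
  let β : (Fin m → ℝ) →L[ℝ] EuclideanSpace ℝ (Fin n) :=
    ((WithLp.linearEquiv 2 ℝ (Fin n → ℝ)).symm.toLinearMap ∘ₗ B.mulVecLin).toContinuousLinearMap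
  let γ : EuclideanSpace ℝ (Fin n) →L[ℝ] (Fin m → ℝ) :=
    (C.mulVecLin ∘ₗ (WithLp.linearEquiv 2 ℝ (Fin n → ℝ)).toLinearMap).toContinuousLinearMap
  have hPt : Pᵀ = P := by simpa using hPd.1.eq
  have hsymm : ∀ x y, inner ℝ (Q x) y = inner ℝ x (Q y) := by
    intro x y
    rw [real_inner_comm, Matrix.inner_toEuclideanCLM, Matrix.inner_toEuclideanCLM,
      Matrix.dotProduct_mulVec, ← Matrix.mulVec_transpose, hPt, dotProduct_comm]
  -- The hypothesis on `P`, transposed; it turns `B s · P z` into `s · C z`.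
  have hCB : Bᵀ * P = C := by
    ext i j
    have h := congrFun (hPB i) j
    rw [← hPt, Matrix.mul_apply]
    simpa [Matrix.mulVec, dotProduct, mul_comm] using h
  have hβγ : ∀ z s, inner ℝ (Q z) (β s) = ∑ i, s i * γ z i := by
    intro z s
    rw [real_inner_comm, Matrix.inner_toEuclideanCLM]
    change (B *ᵥ s) ⬝ᵥ P *ᵥ z.ofLp = s ⬝ᵥ (C *ᵥ z.ofLp)
    rw [← hCB, ← Matrix.mulVec_mulVec, Matrix.dotProduct_mulVec s, Matrix.vecMul_transpose]
  obtain ⟨K, x, hxl, hx0, hxd⟩ := SlidingMode.exists_lipschitzWith_solution hT hFc hF β γ D Q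
    hsymm hc hpos hβγ x₀
  have hxac : AbsolutelyContinuousOnInterval x 0 T :=
    hxl.lipschitzOnWith.absolutelyContinuousOnInterval
  refine ⟨x, ⟨hxac, hx0, ?_⟩, ⟨K, hxl.lipschitzOnWith⟩, ?_⟩
  · rw [ae_restrict_iff' measurableSet_Ioo]
    filter_upwards [hxd, hfF] with t h1 h2 ht
    obtain ⟨s, hs, hd⟩ := h1 ht
    exact ⟨_, hd, s, hs, by rw [h2 ht]; rfl⟩
  · rintro y ⟨hyac, hy0, hyd⟩ t ht
    rw [ae_restrict_iff' measurableSet_Ioo] at hyd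
    -- For true solutions the signs are exactly monotone, so `η = 0` and the two trajectories
    -- coincide.
    have h := SlidingMode.norm_sq_le_of_monotone hF β γ Q hsymm hc hpos hβγ le_rfl hyac hxac
      (hy0.trans hx0.symm) (by
        filter_upwards [hxd, hfF, hyd] with t h1 h2 h3 ht
        obtain ⟨s, hs, hd⟩ := h1 ht
        obtain ⟨_, hd', s', hs', rfl⟩ := h3 ht
        refine ⟨s', s, by rw [h2 ht] at hd'; exact hd', hd, ?_⟩
        rw [neg_zero]
        refine Finset.sum_nonneg fun i _ => ?_
        have := SlidingMode.sgn_monotone (hs' i) (hs i)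
        simp only [Pi.add_apply, add_sub_add_right_eq_sub] at this
        rw [map_sub]
        exact this) t ht
    simp only [mul_zero, zero_mul] at h
    have h0 : ‖y t - x t‖ ^ 2 ≤ 0 := nonpos_of_mul_nonpos_right h hc
    have h1 : ‖y t - x t‖ = 0 := by simpa using le_antisymm h0 (sq_nonneg _)
    exact sub_eq_zero.1 (norm_eq_zero.1 h1)
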